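/- All spaces are Tychonoff. A compactification of a space $X$ is a compact Hausdorff space $bX$ containing $X$ as a dense subspace, and the subspace $bX\setminus X$ is then called a remainder of $X$. A space $M$ is Menger if for every sequence $(\mathcal U_n)_{n\in\mathbb N}$ of open covers of $M$ there are finite $\mathcal V_n\subseteq\mathcal U_n$ with $\bigcup_{n}\bigcup\mathcal V_n=M$. A space $X$ is locally Menger if for each $x\in X$ there are an open set $U\subseteq X$ and a Menger subspace $M$ of $X$ with $x\in U\subseteq M$. A space $X$ is a $p$-space if in some (equivalently, in every) compactification $bX$ of $X$ there are families $\mathcal U_n$ ($n\in\mathbb N$) of open subsets of $bX$ such that $x\in\bigcap_{n}\bigcup\{U\in\mathcal U_n: x\in U\}\subseteq X$ for every $x\in X$. A space $Y$ is an $s$-space if in every (equivalently, in some) compactification $bY$ of $Y$ there is a countable family $\mathcal C$ of open subsets of $bY$ such that $Y$ is a union of sets each of which is the intersection of a nonempty subfamily of $\mathcal C$. A space $Y$ is homogeneous if for all $x,y\in Y$ there is a homeomorphism $f:Y\to Y$ with $f(x)=y$. Theorem. Let $X$ be a locally Menger $p$-space, let $bX$ be a compactification of $X$, and suppose that the remainder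 $Y=bX\setminus X$ is homogeneous. Then $Y$ is an $s$-space. -/

import Mathlib

open Set

universe u v

/-- `X` is Menger: from every sequence of open covers of `X` one can select finite subfamilies
which together cover `X`. -/
def IsMenger (X : Type u) [TopologicalSpace X] : Prop :=
  ∀ 𝒰 : ℕ → Set (Set X), (∀ n, (∀ s ∈ 𝒰 n, IsOpen s) ∧ ⋃₀ 𝒰 n = univ) →
    ∃ 𝒱 : ℕ → Set (Set X), (∀ n, 𝒱 n ⊆ 𝒰 n ∧ (𝒱 n).Finite) ∧ (⋃ n, ⋃₀ 𝒱 n) = univ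

/-- `X` is locally Menger: every point lies in an open set contained in a Menger subspace. -/
def IsLocallyMenger (X : Type u) [TopologicalSpace X] : Prop :=
  ∀ x : X, ∃ U Y : Set X, IsOpen U ∧ IsMenger Y ∧ x ∈ U ∧ U ⊆ Y

/-- `B` together with `e : X → B` is a compactification of `X`: a compact Hausdorff space in which
`X` is densely embedded by `e`. -/
structure IsCompactification {X : Type u} {B : Type v} [TopologicalSpace X] [TopologicalSpace B]
    (e : X → B) : Prop where
  compactSpace : CompactSpace B
  t2Space : T2Space B
  isDenseEmbedding : IsDenseEmbedding e

/-- The remainder `B \ e(X)` of `X` in the compactification `e : X → B`; as a type it carries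
the subspace topology of `B`. -/
def remainder {X : Type u} {B : Type v} (e : X → B) : Set B := (range e)ᶜ

/-- The subset `X` of `B` is feathered in `B`: there are families `𝒰 n` of open sets of `B`
such that for all `x ∈ X` the intersection over `n` of the stars of `x` in `𝒰 n` contains `x`
and is contained in `X`. -/
def IsFeatheredIn {B : Type v} [TopologicalSpace B] (X : Set B) : Prop :=
  ∃ 𝒰 : ℕ → Set (Set B), (∀ n, ∀ U ∈ 𝒰 n, IsOpen U) ∧
    ∀ x ∈ X, x ∈ (⋂ n, ⋃₀ {U ∈ 𝒰 n | x ∈ U}) ∧ (⋂ n, ⋃₀ {U ∈ 𝒰 n | x ∈ U}) ⊆ X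

/-- `X` is a p-space: `X` is feathered in some compactification. Every compactification of `X` is
homeomorphic over `X` to one in the universe of `X`, so the bound on `B` is no restriction. -/
def IsPSpace (X : Type u) [TopologicalSpace X] : Prop :=
  ∃ (B : Type u) (_ : TopologicalSpace B) (e : X → B),
    IsCompactification e ∧ IsFeatheredIn (range e)

/-- All intersections of nonempty subcollections of `𝒞`. -/
def interFamily {B : Type v} (𝒞 : Set (Set B)) : Set (Set B) :=
  {A | ∃ 𝒟 ⊆ 𝒞, 𝒟.Nonempty ∧ A = ⋂₀ 𝒟}

/-- All unions of subcollections of `interFamily 𝒞`. -/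
def unionInterFamily {B : Type v} (𝒞 : Set (Set B)) : Set (Set B) :=
  {A | ∃ ℰ ⊆ interFamily 𝒞, A = ⋃₀ ℰ}

/-- `𝒞` is a source for the subspace `Y` of `B`. -/
def IsSource {B : Type v} (𝒞 : Set (Set B)) (Y : Set B) : Prop :=
  Y ∈ unionInterFamily 𝒞

/-- `Y` has a countable open source in `B`. -/
def HasCountableOpenSource {B : Type v} [TopologicalSpace B] (Y : Set B) : Prop :=
  ∃ 𝒞 : Set (Set B), 𝒞.Countable ∧ (∀ U ∈ 𝒞, IsOpen U) ∧ IsSource 𝒞 Y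

/-- `X` (a Tychonoff space) is an s-space: `X` has a countable open source in every
compactification. Every compactification of `X` is homeomorphic over `X` to one in the universe
of `X`, so the bound on `B` is no restriction. -/
def IsSSpace (X : Type u) [TopologicalSpace X] : Prop :=
  ∀ (B : Type u) [TopologicalSpace B] (e : X → B),
    IsCompactification e → HasCountableOpenSource (range e)

/-- `X` is homogeneous: the self-homeomorphisms of `X` act transitively on points. -/
def IsHomogeneousSpace (X : Type u) [TopologicalSpace X] : Prop :=
  ∀ x y : X, ∃ f : X ≃ₜ X, f x = y

open Topology Filter

/-! If `Y` is closed in `bX`, it is compact and the claim is immediate. Otherwise some point of `X`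
lies in the closure of `Y`, and the local Menger property gives it an open neighbourhood `V` with
`closure V ∩ X` Lindelöf. Inside `V`, compact subsets of `Y` then lie in compact subsets of `Y` of
countable character in `bX` (`IsCompact.exists_seq_isOpen_basis`). Homogeneity carries this from `V`
to all of `Y`, so every compact subset of `Y` lies in a `Gδ` whose trace on `closure Y` stays in
`Y`; hence `closure Y \ Y` is Lindelöf. The feathering now needs only countably many closed sets to
separate these points from the complement of `X`, and complements of closed sets form the source.
Closures of graphs, as closed relations, move such separation between compactifications. -/

/-- A Menger space is Lindelöf. -/
theorem IsMenger.isLindelof_univ {X : Type u} [TopologicalSpace X] (h : IsMenger X) :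
    IsLindelof (univ : Set X) := by
  refine isLindelof_of_countable_subcover fun {ι} U hU hcov => ?_
  obtain ⟨𝒱, h𝒱, hc⟩ := h (fun _ => range U) fun _ =>
    ⟨by rintro _ ⟨i, rfl⟩; exact hU i, by rw [sUnion_range]; exact univ_subset_iff.1 hcov⟩
  have hcount : (⋃ n, 𝒱 n).Countable := countable_iUnion fun n => (h𝒱 n).2.countable
  have hsub : ∀ s ∈ ⋃ n, 𝒱 n, ∃ i, U i = s := fun s hs =>
    let ⟨n, hn⟩ := mem_iUnion.1 hs
    (h𝒱 n).1 hn
  choose i hi using hsub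
  have := hcount.to_subtype
  refine ⟨range fun s : ⋃ n, 𝒱 n => i s s.2, countable_range _, fun x _ => ?_⟩
  obtain ⟨n, s, hs, hxs⟩ := mem_iUnion.1 (hc.symm ▸ mem_univ x : x ∈ ⋃ n, ⋃₀ 𝒱 n)
  have hs' : s ∈ ⋃ n, 𝒱 n := mem_iUnion.2 ⟨n, hs⟩
  exact mem_iUnion₂.2 ⟨i s hs', ⟨⟨s, hs'⟩, rfl⟩, (hi s hs').symm ▸ hxs⟩

/-- Every point of a densely embedded locally Menger space has a neighbourhood in the ambient
regular space whose closure has Lindelöf trace. -/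
theorem IsLocallyMenger.exists_isLindelof_closure_inter_range {X : Type u} {B : Type v}
    [TopologicalSpace X] [TopologicalSpace B] [RegularSpace B] (hX : IsLocallyMenger X)
    {e : X → B} (he : IsInducing e) (x : X) :
    ∃ V : Set B, IsOpen V ∧ e x ∈ V ∧ IsLindelof (closure V ∩ range e) := by
  obtain ⟨U, M, hU, hM, hxU, hUM⟩ := hX x
  obtain ⟨U', hU', rfl⟩ := he.isOpen_iff.1 hU
  obtain ⟨C, hC, hCc, hCU⟩ := exists_mem_nhds_isClosed_subset (hU'.mem_nhds hxU)
  refine ⟨interior C, isOpen_interior, mem_interior_iff_mem_nhds.2 hC, ?_⟩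
  have hML : IsLindelof (e '' M) :=
    (isLindelof_iff_isLindelof_univ.2 hM.isLindelof_univ).image he.continuous
  have hcl : closure (interior C) ⊆ C := closure_minimal interior_subset hCc
  have : closure (interior C) ∩ range e = closure (interior C) ∩ e '' M := by
    refine Subset.antisymm ?_ (inter_subset_inter_right _ (image_subset_range e M))
    rintro _ ⟨hb, z, rfl⟩
    exact ⟨hb, z, hUM (hCU (hcl hb)), rfl⟩
  rw [this]
  exact hML.inter_left isClosed_closure

/-! ### Countable character and homogeneity -/

/-- Between a compact set and a countable intersection of its open neighbourhoods there is a
decreasing sequence of open sets, each containing the closure of the next. -/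
theorem IsCompact.exists_seq_isOpen_closure_subset {B : Type v} [TopologicalSpace B]
    [T2Space B] [CompactSpace B] {L : Set B} (hL : IsCompact L) {G : ℕ → Set B}
    (hG : ∀ n, IsOpen (G n)) (hLG : ∀ n, L ⊆ G n) :
    ∃ H : ℕ → Set B, (∀ n, IsOpen (H n)) ∧ (∀ n, L ⊆ H n) ∧ (∀ n, H n ⊆ G n) ∧
      ∀ n, closure (H (n + 1)) ⊆ H n := by
  have step : ∀ (n : ℕ) (S : {S : Set B // IsOpen S ∧ L ⊆ S}),
      ∃ S' : {S : Set B // IsOpen S ∧ L ⊆ S}, closure S'.1 ⊆ S.1 ∩ G n := by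
    rintro n ⟨S, hS, hLS⟩
    obtain ⟨u, hu, hLu, huc⟩ := normal_exists_closure_subset hL.isClosed (hS.inter (hG n))
      (subset_inter hLS (hLG n))
    exact ⟨⟨u, hu, hLu⟩, huc⟩
  choose next hnext using step
  let S : ℕ → {S : Set B // IsOpen S ∧ L ⊆ S} := fun n =>
    Nat.rec ⟨G 0, hG 0, hLG 0⟩ (fun k s => next (k + 1) s) n
  refine ⟨fun n => (S n).1, fun n => (S n).2.1, fun n => (S n).2.2, ?_, fun n => ?_⟩
  · rintro (_ | n)
    · exact Subset.rfl
    · exact subset_closure.trans ((hnext (n + 1) (S n)).trans inter_subset_right)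
  · exact (hnext (n + 1) (S n)).trans inter_subset_left

/-- If the trace on `closure V` of the complement of `Y` is Lindelöf, then every compact
`L ⊆ V ∩ Y` lies in a compact subset `F` of `Y` of countable character. -/
theorem IsCompact.exists_seq_isOpen_basis {B : Type v} [TopologicalSpace B]
    [T2Space B] [CompactSpace B] {Y V L : Set B} (hV : IsOpen V)
    (hVY : IsLindelof (closure V ∩ Yᶜ)) (hL : IsCompact L) (hLV : L ⊆ V) (hLY : L ⊆ Y) :
    ∃ (F : Set B) (H : ℕ → Set B), IsCompact F ∧ L ⊆ F ∧ F ⊆ Y ∧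
      (∀ n, IsOpen (H n) ∧ F ⊆ H n) ∧ ∀ O, IsOpen O → F ⊆ O → ∃ n, H n ⊆ O := by
  have sep : ∀ p ∈ closure V ∩ Yᶜ, ∃ W ∈ 𝓝 p, IsClosed W ∧ W ⊆ Lᶜ := fun p hp =>
    let ⟨W, h1, h2, h3⟩ := exists_mem_nhds_isClosed_subset
      (hL.isClosed.isOpen_compl.mem_nhds fun h => hp.2 (hLY h))
    ⟨W, h1, h2, h3⟩
  choose! W hW hWc hWL using sep
  obtain ⟨t, htc, htP, ht⟩ := hVY.elim_nhds_subcover W hW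
  -- The intersection of this family lies in `Y`: `V` confines it to where the sets `W p` cover the
  -- complement of `Y`.
  have hcount : (insert V ((fun p => (W p)ᶜ) '' t)).Countable := (htc.image _).insert V
  obtain ⟨G, hGeq⟩ := hcount.exists_eq_range (insert_nonempty _ _)
  have hGprop : ∀ n, IsOpen (G n) ∧ L ⊆ G n := by
    intro n
    have : G n ∈ insert V ((fun p => (W p)ᶜ) '' t) := hGeq ▸ mem_range_self n
    rcases this with h | ⟨p, hp, h⟩
    · rw [h]; exact ⟨hV, hLV⟩
    · rw [← h]
      exact ⟨(hWc p (htP p hp)).isOpen_compl, subset_compl_comm.1 (hWL p (htP p hp))⟩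
  obtain ⟨H, hHo, hLH, hHG, hHc⟩ := hL.exists_seq_isOpen_closure_subset
    (fun n => (hGprop n).1) (fun n => (hGprop n).2)
  have hanti : Antitone fun n => closure (H n) :=
    antitone_nat_of_succ_le fun n => (hHc n).trans subset_closure
  have hF : ⋂ n, closure (H n) ⊆ ⋂ n, H n :=
    subset_iInter fun n => (iInter_subset _ (n + 1)).trans (hHc n)
  refine ⟨⋂ n, closure (H n), H, (isClosed_iInter fun _ => isClosed_closure).isCompact,
    subset_iInter fun n => (hLH n).trans subset_closure, ?_,
    fun n => ⟨hHo n, hF.trans (iInter_subset _ n)⟩, fun O hO hFO => ?_⟩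
  · intro b hb
    by_contra hbY
    have hbG : ∀ S ∈ insert V ((fun p => (W p)ᶜ) '' t), b ∈ S := by
      rw [hGeq]
      rintro _ ⟨n, rfl⟩
      exact hHG n (mem_iInter.1 (hF hb) n)
    have hbV : b ∈ V := hbG V (mem_insert _ _)
    obtain ⟨p, hp, hbp⟩ := mem_iUnion₂.1 (ht ⟨subset_closure hbV, hbY⟩)
    exact hbG _ (mem_insert_of_mem _ ⟨p, hp, rfl⟩) hbp
  · obtain ⟨n, hn⟩ := exists_subset_nhds_of_isCompact
      (directed_of_isDirected_le fun _ _ h => hanti h)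
      (fun n => (isClosed_closure (s := H n)).isCompact) fun x hx => hO.mem_nhds (hFO hx)
    exact ⟨n, subset_closure.trans hn⟩

/-- A self-homeomorphism of `Y` carries compact subsets of countable character to sets that are
`Gδ` relative to the closure of `Y`. -/
theorem exists_isGδ_of_homeomorph {B : Type v} [TopologicalSpace B]
    [T2Space B] [CompactSpace B] {Y V : Set B} (hV : IsOpen V)
    (hVY : IsLindelof (closure V ∩ Yᶜ)) (f : Y ≃ₜ Y) {K : Set Y} (hK : IsCompact K)
    (hKV : ∀ y ∈ K, (f y : B) ∈ V) :
    ∃ G : Set B, IsGδ G ∧ (↑) '' K ⊆ G ∧ G ∩ closure Y ⊆ Y := by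
  obtain ⟨F, H, hF, hLF, hFY, hH, hbasis⟩ :=
    ((hK.image f.continuous).image continuous_subtype_val).exists_seq_isOpen_basis hV hVY
      (by rintro _ ⟨_, ⟨y, hy, rfl⟩, rfl⟩; exact hKV y hy) (Subtype.coe_image_subset Y _)
  have hopen : ∀ n, ∃ O : Set B, IsOpen O ∧ (↑) ⁻¹' O = {y : Y | (f y : B) ∈ H n} := fun n =>
    isOpen_induced_iff.1 ((hH n).1.preimage (continuous_subtype_val.comp f.continuous))
  choose O hO hOH using hopen
  have hOmem : ∀ n (y : Y), (y : B) ∈ O n ↔ (f y : B) ∈ H n := fun n y => Set.ext_iff.1 (hOH n) y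
  refine ⟨⋂ n, O n, IsGδ.iInter_of_isOpen hO, ?_, ?_⟩
  · rintro _ ⟨y, hy, rfl⟩
    exact mem_iInter.2 fun n =>
      (hOmem n y).2 ((hH n).2 (hLF ⟨_, ⟨y, hy, rfl⟩, rfl⟩))
  · rintro x ⟨hxO, hxY⟩
    by_contra hx
    have hF' : IsCompact ((↑) '' (f ⁻¹' ((↑) ⁻¹' F)) : Set B) :=
      (f.isCompact_preimage.2 (IsInducing.subtypeVal.isCompact_preimage' hF
        (by simpa using hFY))).image continuous_subtype_val
    -- The sets `O n ∩ Y` are the preimages of the `H n` under `f`, so one of them lies in `D`,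
    -- although `x` is in the closure of each.
    obtain ⟨D, hD, hFD, hDx⟩ := normal_exists_closure_subset hF'.isClosed
      (isClosed_singleton (x := x)).isOpen_compl
      (by rintro _ ⟨y, -, rfl⟩ rfl; exact hx y.2)
    obtain ⟨D', hD', hDD'⟩ := isOpen_induced_iff.1
      (hD.preimage (continuous_subtype_val.comp f.symm.continuous))
    have hD'mem : ∀ y : Y, (y : B) ∈ D' ↔ (f.symm y : B) ∈ D := fun y => Set.ext_iff.1 hDD' y
    obtain ⟨n, hn⟩ := hbasis D' hD' fun p hp =>
      (hD'mem ⟨p, hFY hp⟩).2 (hFD ⟨_, by simpa using hp, rfl⟩)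
    have hOD : O n ∩ Y ⊆ D := by
      rintro p ⟨hpO, hpY⟩
      simpa using (hD'mem (f ⟨p, hpY⟩)).1 (hn ((hOmem n ⟨p, hpY⟩).1 hpO))
    exact hDx (closure_mono hOD ((hO n).inter_closure ⟨mem_iInter.1 hxO n, hxY⟩)) rfl

/-- For homogeneous `Y` whose complement is somewhere locally Lindelöf near `Y`, every compact
subset of `Y` is contained in a `Gδ` set whose trace on `closure Y` lies in `Y`. -/
theorem IsHomogeneousSpace.exists_isGδ {B : Type v} [TopologicalSpace B]
    [T2Space B] [CompactSpace B] {Y V : Set B} (hY : IsHomogeneousSpace Y) (hV : IsOpen V)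
    (hVY : IsLindelof (closure V ∩ Yᶜ)) (hne : (V ∩ Y).Nonempty) {K : Set Y}
    (hK : IsCompact K) :
    ∃ G : Set B, IsGδ G ∧ (↑) '' K ⊆ G ∧ G ∩ closure Y ⊆ Y := by
  obtain ⟨y₀, hy₀V, hy₀⟩ := hne
  -- The property passes to finite unions, so it suffices to treat a closed piece of `K` near each
  -- point, small enough to be moved into `V`.
  refine hK.induction_on
    (p := fun S => ∃ G : Set B, IsGδ G ∧ (↑) '' S ⊆ G ∧ G ∩ closure Y ⊆ Y) ?_ ?_ ?_ ?_
  · exact ⟨∅, .empty, by simp, by simp⟩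
  · rintro S T hST ⟨G, h1, h2, h3⟩
    exact ⟨G, h1, (image_mono hST).trans h2, h3⟩
  · rintro S T ⟨G, h1, h2, h3⟩ ⟨G', h1', h2', h3'⟩
    refine ⟨G ∪ G', h1.union h1', ?_, ?_⟩
    · rw [image_union]; exact union_subset_union h2 h2'
    · rw [union_inter_distrib_right]; exact union_subset h3 h3'
  · intro y _
    obtain ⟨f, hf⟩ := hY y ⟨y₀, hy₀⟩
    have hN : {z : Y | (f z : B) ∈ V} ∈ 𝓝 y :=
      (hV.preimage (continuous_subtype_val.comp f.continuous)).mem_nhds (by simpa [hf] using hy₀V)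
    obtain ⟨C, hC, hCc, hCV⟩ := exists_mem_nhds_isClosed_subset hN
    exact ⟨K ∩ C, inter_mem_nhdsWithin K hC,
      exists_isGδ_of_homeomorph hV hVY f (hK.inter_right hCc) fun z hz => hCV hz.2⟩

/-- If every compact subset of `Y` is contained in a `Gδ` set whose trace on `closure Y` lies in
`Y`, then the complement of `Y` in `closure Y` is Lindelöf. -/
theorem isLindelof_closure_inter_compl {B : Type v} [TopologicalSpace B]
    [CompactSpace B] {Y : Set B}
    (h : ∀ K : Set Y, IsCompact K → ∃ G : Set B, IsGδ G ∧ (↑) '' K ⊆ G ∧ G ∩ closure Y ⊆ Y) :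
    IsLindelof (closure Y ∩ Yᶜ) := by
  refine isLindelof_of_countable_subcover fun {ι} U hU hcov => ?_
  have hKc : IsCompact (closure Y ∩ (⋃ i, U i)ᶜ) :=
    (isClosed_closure.inter (isOpen_iUnion hU).isClosed_compl).isCompact
  have hKY : closure Y ∩ (⋃ i, U i)ᶜ ⊆ Y := fun b hb => by
    by_contra hbY
    exact hb.2 (hcov ⟨hb.1, hbY⟩)
  obtain ⟨G, hG, hKG, hGY⟩ := h ((↑) ⁻¹' (closure Y ∩ (⋃ i, U i)ᶜ))
    (IsInducing.subtypeVal.isCompact_preimage' hKc (by simpa using hKY))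
  obtain ⟨g, hg, rfl⟩ := hG.eq_iInter_nat
  -- Off `G`, `closure Y` is σ-compact, and it is covered by the `U i` because the uncovered part
  -- lies in `G`.
  have hL : IsLindelof (⋃ n, closure Y ∩ (g n)ᶜ) := isLindelof_iUnion fun n =>
    (isClosed_closure.inter (hg n).isClosed_compl).isCompact.isLindelof
  obtain ⟨t, ht, htU⟩ := hL.elim_countable_subcover U hU (iUnion_subset fun n b hb => by
    by_contra hbU
    exact hb.2 (mem_iInter.1 (hKG ⟨⟨b, hKY ⟨hb.1, hbU⟩⟩, ⟨hb.1, hbU⟩, rfl⟩) n))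
  refine ⟨t, ht, fun b hb => htU ?_⟩
  have : b ∉ ⋂ n, g n := fun hbg => hb.2 (hGY ⟨hbg, hb.1⟩)
  obtain ⟨n, hn⟩ := not_forall.1 (mt mem_iInter.2 this)
  exact mem_iUnion.2 ⟨n, hb.1, hn⟩

/-! ### Countable separation and its transfer -/

/-- A Lindelöf subset of a feathered set `X` is separated from the complement of `X` by the
members of a countable family of closed sets. -/
theorem IsFeatheredIn.exists_countable_isClosed {B : Type v} [TopologicalSpace B]
    [RegularSpace B] {X Z : Set B} (hX : IsFeatheredIn X) (hZ : IsLindelof Z) (hZX : Z ⊆ X) :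
    ∃ 𝒟 : Set (Set B), 𝒟.Countable ∧ (∀ D ∈ 𝒟, IsClosed D) ∧
      ∀ x ∈ Z, ∀ b ∉ X, ∃ D ∈ 𝒟, x ∈ D ∧ b ∉ D := by
  obtain ⟨𝒰, hopen, hstar⟩ := hX
  have key : ∀ n, ∀ x ∈ Z, ∃ W ∈ 𝓝 x, IsClosed W ∧ ∃ U ∈ 𝒰 n, W ⊆ U := by
    intro n x hx
    obtain ⟨U, hU, hxU⟩ := mem_iInter.1 (hstar x (hZX hx)).1 n
    obtain ⟨W, h1, h2, h3⟩ := exists_mem_nhds_isClosed_subset ((hopen n U hU.1).mem_nhds hxU)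
    exact ⟨W, h1, h2, U, hU.1, h3⟩
  choose! W hW hWc hWU using key
  choose t htc htZ ht using fun n => hZ.elim_nhds_subcover (W n) (hW n)
  refine ⟨⋃ n, W n '' t n, countable_iUnion fun n => (htc n).image _, ?_, ?_⟩
  · intro D hD
    obtain ⟨n, p, hp, rfl⟩ := mem_iUnion.1 hD
    exact hWc n p (htZ n p hp)
  · intro x hx b hb
    -- Some star of `x` misses `b`; so does any member of that cover containing `x`.
    obtain ⟨n, hn⟩ := not_forall.1 (mt mem_iInter.2 fun h => hb ((hstar x (hZX hx)).2 h))
    obtain ⟨p, hp, hxp⟩ := mem_iUnion₂.1 (ht n hx)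
    obtain ⟨U, hU, hWU⟩ := hWU n p (htZ n p hp)
    exact ⟨W n p, mem_iUnion.2 ⟨n, p, hp, rfl⟩, hxp, fun hbW => hn ⟨U, ⟨hU, hWU hxp⟩, hWU hbW⟩⟩

section GraphClosure

variable {Z P Q : Type*} [TopologicalSpace P] [TopologicalSpace Q]

/-- The closure of the graph of the partial map `f z ↦ g z` between two spaces containing `Z`. -/
def graphClosure (f : Z → P) (g : Z → Q) : Set (P × Q) := closure (range fun z => (f z, g z))

/-- The image of `D` under the closed relation `graphClosure f g`. -/
def graphClosureImage (f : Z → P) (g : Z → Q) (D : Set P) : Set Q :=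
  {q | ∃ p ∈ D, (p, q) ∈ graphClosure f g}

variable {f : Z → P} {g : Z → Q}

theorem mk_mem_graphClosure (z : Z) : (f z, g z) ∈ graphClosure f g :=
  subset_closure (mem_range_self z)

/-- Points related by `graphClosure f g` are the limits of `f` and `g` along a common
ultrafilter. -/
theorem exists_ultrafilter_of_mem_graphClosure {p : P} {q : Q} (h : (p, q) ∈ graphClosure f g) :
    ∃ u : Ultrafilter Z, Tendsto f u (𝓝 p) ∧ Tendsto g u (𝓝 q) := by
  have hne : (comap (fun z => (f z, g z)) (𝓝 (p, q))).NeBot :=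
    comap_neBot_iff.2 fun t ht =>
      let ⟨_, hxt, z, hz⟩ := mem_closure_iff_nhds.1 h t ht
      ⟨z, by subst hz; exact hxt⟩
  refine ⟨Ultrafilter.of (comap (fun z => (f z, g z)) (𝓝 (p, q))), ?_⟩
  have hlim := (tendsto_comap (f := fun z => (f z, g z)) (x := 𝓝 (p, q))).mono_left
    (Ultrafilter.of_le _)
  exact ⟨(continuous_fst.tendsto (p, q)).comp hlim, (continuous_snd.tendsto (p, q)).comp hlim⟩

/-- Since `f` is inducing, the ultrafilter converges already in `Z`: over points of `Z` the closure
adds nothing to the graph. -/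
theorem eq_right_of_mem_graphClosure [TopologicalSpace Z] [T2Space Q] (hf : IsInducing f)
    (hg : Continuous g) {z : Z} {q : Q} (h : (f z, q) ∈ graphClosure f g) : q = g z := by
  obtain ⟨u, h1, h2⟩ := exists_ultrafilter_of_mem_graphClosure h
  exact tendsto_nhds_unique h2 ((hg.tendsto z).comp (hf.tendsto_nhds_iff.2 h1))

theorem eq_left_of_mem_graphClosure [TopologicalSpace Z] [T2Space P] (hf : Continuous f)
    (hg : IsInducing g) {z : Z} {p : P} (h : (p, g z) ∈ graphClosure f g) : p = f z := by
  obtain ⟨u, h1, h2⟩ := exists_ultrafilter_of_mem_graphClosure h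
  exact tendsto_nhds_unique h1 ((hf.tendsto z).comp (hg.tendsto_nhds_iff.2 h2))

theorem isClosed_graphClosureImage [CompactSpace P] {D : Set P} (hD : IsClosed D) :
    IsClosed (graphClosureImage f g D) := by
  have : graphClosureImage f g D = Prod.snd '' (Prod.fst ⁻¹' D ∩ graphClosure f g) := by
    ext q
    simp [graphClosureImage]
  rw [this]
  exact isClosedMap_snd_of_compactSpace _ ((hD.preimage continuous_fst).inter isClosed_closure)

theorem isClosed_setOf_mk_mem_graphClosure (q : Q) :
    IsClosed {p : P | (p, q) ∈ graphClosure f g} :=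
  isClosed_closure.preimage (by fun_prop)

theorem exists_mem_graphClosure [CompactSpace P] [T2Space Q] (hg : DenseRange g) (q : Q) :
    ∃ p ∈ closure (range f), (p, q) ∈ graphClosure f g := by
  have hcl : IsClosed (graphClosureImage f g (closure (range f))) :=
    isClosed_graphClosureImage isClosed_closure
  refine closure_minimal ?_ hcl (hg q)
  rintro _ ⟨z, rfl⟩
  exact ⟨f z, subset_closure (mem_range_self z), mk_mem_graphClosure z⟩

end GraphClosure

/-- Separation of the points of `Z ⊆ X` from the complement of `X` by countably many closed sets
passes from one compactification of `X` to another. -/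
theorem exists_countable_isClosed_transfer {X P Q : Type*} [TopologicalSpace X]
    [TopologicalSpace P] [TopologicalSpace Q] [CompactSpace P] [T2Space Q]
    {f : X → P} {g : X → Q} (hf : IsInducing f) (hg : IsInducing g) {Z : Set X}
    (h : ∃ 𝒟 : Set (Set P), 𝒟.Countable ∧ (∀ D ∈ 𝒟, IsClosed D) ∧
      ∀ x ∈ Z, ∀ b ∉ range f, ∃ D ∈ 𝒟, f x ∈ D ∧ b ∉ D) :
    ∃ 𝒟 : Set (Set Q), 𝒟.Countable ∧ (∀ D ∈ 𝒟, IsClosed D) ∧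
      ∀ x ∈ Z, ∀ b ∉ range g, ∃ D ∈ 𝒟, g x ∈ D ∧ b ∉ D := by
  obtain ⟨𝒟, hc, hcl, hsep⟩ := h
  have hfin : {s : Set (Set P) | s.Finite ∧ s ⊆ 𝒟}.Countable := countable_ofPred_finite_subset hc
  -- Finite intersections are needed because `b` may be related to many points of `P`; these form a
  -- compact set, so finitely many members of `𝒟` exclude them all.
  refine ⟨(fun s => graphClosureImage f g (⋂₀ s)) '' {s | s.Finite ∧ s ⊆ 𝒟}, hfin.image _, ?_, ?_⟩
  · rintro _ ⟨s, hs, rfl⟩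
    exact isClosed_graphClosureImage (isClosed_sInter fun D hD => hcl D (hs.2 hD))
  · intro x hx b hb
    have hT : IsCompact {p : P | (p, b) ∈ graphClosure f g} :=
      (isClosed_setOf_mk_mem_graphClosure b).isCompact
    have hTX : ∀ p, (p, b) ∈ graphClosure f g → p ∉ range f := by
      rintro _ hp ⟨z, rfl⟩
      exact hb ⟨z, (eq_right_of_mem_graphClosure hf hg.continuous hp).symm⟩
    obtain ⟨s, hs, hsfin, hsT⟩ := hT.elim_finite_subcover_image (b := {D ∈ 𝒟 | f x ∈ D})
      (c := compl) (fun D hD => (hcl D hD.1).isOpen_compl) fun p hp => by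
        obtain ⟨D, hD, hxD, hpD⟩ := hsep x hx p (hTX p hp)
        exact mem_iUnion₂.2 ⟨D, ⟨hD, hxD⟩, hpD⟩
    refine ⟨_, ⟨s, ⟨hsfin, fun D hD => (hs hD).1⟩, rfl⟩,
      ⟨f x, fun D hD => (hs hD).2, mk_mem_graphClosure x⟩, ?_⟩
    rintro ⟨p, hp, hpb⟩
    obtain ⟨D, hD, hpD⟩ := mem_iUnion₂.1 (hsT hpb)
    exact hpD (hp D hD)

/-- A countable family of closed sets separating the points outside `Y` from the points of `Y`
yields a countable open source of `Y`. -/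
theorem hasCountableOpenSource_of_isClosed {B : Type v} [TopologicalSpace B] {Y : Set B}
    {𝒟 : Set (Set B)} (hc : 𝒟.Countable) (hcl : ∀ D ∈ 𝒟, IsClosed D)
    (hsep : ∀ x ∉ Y, ∀ y ∈ Y, ∃ D ∈ 𝒟, x ∈ D ∧ y ∉ D) : HasCountableOpenSource Y := by
  -- `univ` keeps the subfamily chosen for `y` nonempty even when every member of `𝒟` contains `y`.
  refine ⟨insert univ (compl '' 𝒟), (hc.image _).insert _, ?_, ?_⟩
  · rintro _ (rfl | ⟨D, hD, rfl⟩)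
    · exact isOpen_univ
    · exact (hcl D hD).isOpen_compl
  · refine ⟨{A ∈ interFamily (insert univ (compl '' 𝒟)) | A ⊆ Y}, fun A hA => hA.1, ?_⟩
    refine Subset.antisymm (fun y hy => ?_) (sUnion_subset fun A hA => hA.2)
    refine ⟨⋂₀ {C ∈ insert univ (compl '' 𝒟) | y ∈ C},
      ⟨⟨_, sep_subset _ _, ⟨univ, mem_insert _ _, mem_univ y⟩, rfl⟩, fun b hb => ?_⟩,
      fun C hC => hC.2⟩
    by_contra hbY
    obtain ⟨D, hD, hbD, hyD⟩ := hsep b hbY y hy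
    exact hb Dᶜ ⟨mem_insert_of_mem _ ⟨D, hD, rfl⟩, hyD⟩ hbD

/-- A compact space is an s-space. -/
theorem IsSSpace.of_compactSpace {Y : Type u} [TopologicalSpace Y] [CompactSpace Y] :
    IsSSpace Y := by
  intro B _ i hi
  have := hi.t2Space
  have hr : range i = univ := by
    rw [← hi.isDenseEmbedding.dense.closure_range,
      (isCompact_range hi.isDenseEmbedding.continuous).isClosed.closure_eq]
  rw [hr]
  exact hasCountableOpenSource_of_isClosed countable_empty (by simp) (by simp)

/-- If a subspace `Y` of a compact Hausdorff space is separated from the rest of its closure by a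
countable family of closed sets, then `Y` is an s-space. -/
theorem IsSSpace.of_isClosed {B : Type u} [TopologicalSpace B] [CompactSpace B] [T2Space B]
    {Y : Set B} {𝒟 : Set (Set B)} (hc : 𝒟.Countable) (hcl : ∀ D ∈ 𝒟, IsClosed D)
    (hsep : ∀ x ∈ closure Y, x ∉ Y → ∀ y ∈ Y, ∃ D ∈ 𝒟, x ∈ D ∧ y ∉ D) : IsSSpace Y := by
  intro B' _ i hi
  have := hi.t2Space
  refine hasCountableOpenSource_of_isClosed
    (hc.image (graphClosureImage ((↑) : Y → B) i)) ?_ ?_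
  · rintro _ ⟨D, hD, rfl⟩
    exact isClosed_graphClosureImage (hcl D hD)
  · rintro x hx _ ⟨y, rfl⟩
    -- Single sets suffice here: one `p` related to `x` is enough, and `y` is related only to
    -- itself.
    obtain ⟨p, hp, hpx⟩ := exists_mem_graphClosure (f := ((↑) : Y → B))
      hi.isDenseEmbedding.dense x
    have hpY : p ∉ Y := fun h =>
      hx ⟨⟨p, h⟩, (eq_right_of_mem_graphClosure (z := ⟨p, h⟩) IsInducing.subtypeVal
        hi.isDenseEmbedding.continuous hpx).symm⟩
    obtain ⟨D, hD, hpD, hyD⟩ := hsep p (by simpa using hp) hpY y y.2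
    refine ⟨_, mem_image_of_mem _ hD, ⟨p, hpD, hpx⟩, ?_⟩
    rintro ⟨q, hq, hqy⟩
    rw [eq_left_of_mem_graphClosure continuous_subtype_val hi.isDenseEmbedding.isInducing hqy]
      at hq
    exact hyD hq

theorem mainTheorem10 {X : Type u} [TopologicalSpace X] [T35Space X]
    (hX : IsLocallyMenger X) (hp : IsPSpace X)
    {B : Type v} [TopologicalSpace B] (e : X → B) (he : IsCompactification e)
    (hY : IsHomogeneousSpace (remainder e)) :
    IsSSpace (remainder e) := by
  have := he.compactSpace
  have := he.t2Space
  by_cases hclosed : closure (remainder e) ⊆ remainder e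
  · have : CompactSpace (remainder e) :=
      isCompact_iff_compactSpace.1 (closure_subset_iff_isClosed.1 hclosed).isCompact
    exact .of_compactSpace
  obtain ⟨b, hb, hbY⟩ := not_subset.1 hclosed
  obtain ⟨x, rfl⟩ := not_not.1 hbY
  have hemb := he.isDenseEmbedding
  obtain ⟨V, hV, hxV, hVL⟩ := hX.exists_isLindelof_closure_inter_range hemb.isInducing x
  have hcompl : (remainder e)ᶜ = range e := compl_compl _
  have hL : IsLindelof (closure (remainder e) ∩ (remainder e)ᶜ) :=
    isLindelof_closure_inter_compl fun K hK =>
      hY.exists_isGδ hV (hcompl ▸ hVL) (mem_closure_iff.1 hb V hV hxV) hK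
  have hZ : IsLindelof (e ⁻¹' closure (remainder e)) := by
    rw [hemb.isInducing.isLindelof_iff, image_preimage_eq_inter_range, ← hcompl]
    exact hL
  obtain ⟨B₀, _, e₀, he₀, hfeath⟩ := hp
  have := he₀.compactSpace
  have := he₀.t2Space
  obtain ⟨𝒟₀, hc₀, hcl₀, hsep₀⟩ := hfeath.exists_countable_isClosed
    (hZ.image he₀.isDenseEmbedding.continuous) (image_subset_range _ _)
  obtain ⟨𝒟, hc, hcl, hsep⟩ := exists_countable_isClosed_transfer (g := e)
    he₀.isDenseEmbedding.isInducing hemb.isInducing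
    ⟨𝒟₀, hc₀, hcl₀, fun z hz => hsep₀ _ (mem_image_of_mem e₀ hz)⟩
  refine .of_isClosed hc hcl fun a ha haY y hy => ?_
  obtain ⟨z, rfl⟩ := not_not.1 haY
  exact hsep z ha y hy
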